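/- \textbf{Proposition (Reduction).} Let $\mathscr{A}$ and $\mathscr{B}$ be unital C$^*$-algebras, and let $\mathscr{A}\otimes\mathscr{B}$ be a C$^*$-tensor product of them, i.e. the completion of the algebraic tensor product in a C$^*$-norm. A state is a positive linear functional $\rho$ with $\rho(\mathbb{I})=1$; $\mathscr{S}(\cdot)$ denotes the set of states. For $\rho\in\mathscr{S}(\mathscr{A})$ and $\tau\in\mathscr{S}(\mathscr{B})$, let $\rho\otimes\tau$ be the unique state on $\mathscr{A}\otimes\mathscr{B}$ with $(\rho\otimes\tau)(a\otimes b)=\rho(a)\tau(b)$. For a state $\sigma$ on a C$^*$-algebra and an element $Y$ of it with $\sigma(Y^\dagger Y)\neq 0$, the reduced state $\sigma_Y$ is $$\sigma_Y(D)=\frac{\sigma(Y^\dagger D Y)}{\sigma(Y^\dagger Y)}.$$ Fix a $*$-automorphism $\alpha$ of $\mathscr{A}\otimes\mathscr{B}$ and a state $\tau\in\mathscr{S}(\mathscr{B})$, and put $\mathbf{M}^*(\rho)=(\rho\otimes\tau)\circ\alpha$ for $\rho\in\mathscr{S}(\mathscr{A})$. Let $\mathbf{P}\in\mathscr{A}$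 and $\mathbf{Q}\in\mathscr{A}\otimes\mathscr{B}$ be (orthogonal) projections such that $\mathbf{M}^*(\rho)(\mathbf{Q})=\rho(\mathbf{P})$ for all $\rho\in\mathscr{S}(\mathscr{A})$. Then for every $\rho\in\mathscr{S}(\mathscr{A})$ with $\rho(\mathbf{P})\neq 0$, also $\mathbf{M}^*(\rho)(\mathbf{Q})\neq 0$, and $$(\mathbf{M}^*(\rho))_{\mathbf{Q}}=\mathbf{M}^*(\rho_{\mathbf{P}}).$$ -/

import Mathlib

open scoped TensorProduct ComplexOrder

/-- A state on a unital C⋆-algebra: a positive linear functional `ρ` with `ρ 1 = 1`. -/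
structure CStarState (A : Type*) [CStarAlgebra A] [PartialOrder A] [StarOrderedRing A]
    extends A →ₚ[ℂ] ℂ where
  map_one' : toFun 1 = 1

namespace CStarState

section Basic

variable {A : Type*} [CStarAlgebra A] [PartialOrder A] [StarOrderedRing A]

noncomputable instance : FunLike (CStarState A) A ℂ where
  coe ρ := ρ.toPositiveLinearMap
  coe_injective ρ σ h := by
    cases ρ
    cases σ
    congr
    exact DFunLike.coe_injective h

instance : LinearMapClass (CStarState A) ℂ A ℂ where
  map_add ρ := map_add ρ.toPositiveLinearMap
  map_smulₛₗ ρ := map_smul ρ.toPositiveLinearMap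

instance : OrderHomClass (CStarState A) A ℂ where
  map_rel ρ := fun {_ _} h => ρ.monotone' h

@[ext]
theorem ext {ρ σ : CStarState A} (h : ∀ a, ρ a = σ a) : ρ = σ :=
  DFunLike.ext _ _ h

protected theorem map_one (ρ : CStarState A) : ρ 1 = 1 := ρ.map_one'

/-- Build a state from a unital linear functional that is nonnegative on nonnegative elements. -/
noncomputable def mk₀ (f : A →ₗ[ℂ] ℂ) (hf : ∀ a, 0 ≤ a → 0 ≤ f a) (h1 : f 1 = 1) : CStarState A where
  toPositiveLinearMap := PositiveLinearMap.mk₀ f hf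
  map_one' := h1

@[simp]
theorem mk₀_apply (f : A →ₗ[ℂ] ℂ) (hf : ∀ a, 0 ≤ a → 0 ≤ f a) (h1 : f 1 = 1) (a : A) :
    mk₀ f hf h1 a = f a := rfl

/-- The reduced state `ρ_Y`, i.e. `ρ_Y(a) = ρ(Y† a Y) / ρ(Y† Y)`, defined when `ρ(Y† Y) ≠ 0`. -/
noncomputable def reduced (ρ : CStarState A) (Y : A) (hY : ρ (star Y * Y) ≠ 0) : CStarState A :=
  mk₀
    { toFun := fun a => ρ (star Y * a * Y) / ρ (star Y * Y)
      map_add' := fun a b => by rw [mul_add, add_mul, map_add, add_div]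
      map_smul' := fun c a => by
        rw [mul_smul_comm, smul_mul_assoc, map_smul, RingHom.id_apply, smul_eq_mul, smul_eq_mul,
          mul_div_assoc] }
    (fun a ha => div_nonneg (map_nonneg ρ (star_left_conjugate_nonneg ha Y))
      (map_nonneg ρ (star_mul_self_nonneg Y)))
    (by simp [hY])

/-- The dual action of a ⋆-homomorphism on states, `α^*(ρ) = ρ ∘ α`. -/
noncomputable def pullback {D : Type*} [CStarAlgebra D] [PartialOrder D] [StarOrderedRing D]
    (α : A →⋆ₐ[ℂ] D) (ρ : CStarState D) : CStarState A :=
  mk₀ ((ρ.toPositiveLinearMap.toLinearMap).comp α.toAlgHom.toLinearMap)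
    (fun a ha => map_nonneg ρ (map_nonneg α ha))
    (by
      change ρ (α 1) = 1
      rw [map_one, ρ.map_one])

@[simp]
theorem pullback_apply {D : Type*} [CStarAlgebra D] [PartialOrder D] [StarOrderedRing D]
    (α : A →⋆ₐ[ℂ] D) (ρ : CStarState D) (a : A) : pullback α ρ a = ρ (α a) := rfl

theorem norm_apply_le (ρ : CStarState A) (a : A) : ‖ρ a‖ ≤ 4 * ‖a‖ := by
  obtain ⟨y, hy0, hyn, hy⟩ := CStarAlgebra.exists_sum_four_nonneg a
  conv_lhs => rw [hy]
  simp only [map_sum, map_smul]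
  refine (norm_sum_le _ _).trans ?_
  have : ∀ i : Fin 4, ‖(Complex.I ^ (i : ℕ)) • ρ (y i)‖ ≤ ‖a‖ := by
    intro i
    rw [norm_smul, norm_pow, Complex.norm_I, one_pow, one_mul]
    have h := PositiveLinearMap.norm_apply_le_of_nonneg ρ.toPositiveLinearMap (y i) (hy0 i)
    have h1 : ρ.toPositiveLinearMap 1 = 1 := ρ.map_one
    rw [h1, norm_one, one_mul] at h
    exact h.trans (hyn i)
  refine (Finset.sum_le_sum (g := fun _ => ‖a‖) (fun i _ => this i)).trans (by simp)

end Basic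

section Extension

variable {A B D : Type*}
  [CStarAlgebra A] [PartialOrder A] [StarOrderedRing A]
  [CStarAlgebra B] [PartialOrder B] [StarOrderedRing B]
  [CStarAlgebra D] [PartialOrder D] [StarOrderedRing D]

theorem posPart_conj {A : Type*} [CStarAlgebra A] [PartialOrder A] [StarOrderedRing A]
    (a : A) (ha : IsSelfAdjoint a) (s : ℝ) :
    ∃ c : A, 0 ≤ c ∧ c * a * c = s • (c * c) - c * c * c ∧
      (c = 0 → algebraMap ℝ A s ≤ a) := by
  set x : A := algebraMap ℝ A s - a with hx
  have hxs : IsSelfAdjoint x := (IsSelfAdjoint.algebraMap A (.all s)).sub ha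
  refine ⟨x⁺, CFC.posPart_nonneg x, ?_, fun h => ?_⟩
  · have h1 : x⁺ * x = x⁺ * x⁺ := by
      have h := congrArg (fun z => x⁺ * z) (CFC.posPart_sub_negPart x hxs)
      simpa only [mul_sub, CFC.posPart_mul_negPart, sub_zero] using h.symm
    have h2 : a = algebraMap ℝ A s - x := by rw [hx]; abel
    rw [h2, mul_sub, sub_mul, h1, Algebra.algebraMap_eq_smul_one]
    simp
  · have := (CFC.posPart_eq_zero_iff x hxs).1 h
    rwa [hx, sub_nonpos] at this

theorem eq_zero_of_mul_self {c : A} (hc : 0 ≤ c) (h : c * c = 0) : c = 0 := by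
  rw [← CStarRing.star_mul_self_eq_zero_iff, hc.isSelfAdjoint.star_eq, h]

/-- If `i a + j b ≥ 0` for commuting independent copies, then `s ≤ a` or `-s ≤ b`. -/
theorem le_or_le_of_add_nonneg (i : A →⋆ₐ[ℂ] D) (j : B →⋆ₐ[ℂ] D)
    (hij : ∀ a b, Commute (i a) (j b)) (h0 : ∀ a b, i a * j b = 0 → a = 0 ∨ b = 0)
    {a : A} {b : B} (ha : IsSelfAdjoint a) (hb : IsSelfAdjoint b) (hab : 0 ≤ i a + j b) (s : ℝ) :
    algebraMap ℝ A s ≤ a ∨ algebraMap ℝ B (-s) ≤ b := by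
  obtain ⟨c, hc, hc2, hc3⟩ := posPart_conj a ha s
  obtain ⟨d, hd, hd2, hd3⟩ := posPart_conj b hb (-s)
  have hic : 0 ≤ i c := map_nonneg i hc
  have hjd : 0 ≤ j d := map_nonneg j hd
  have e1 : i c * i a * i c = (s : ℂ) • (i c * i c) - i c * i c * i c := by
    have := congrArg i hc2
    rw [← Complex.coe_smul s] at this
    simpa only [map_mul, map_sub, map_smul] using this
  have e2 : j d * j b * j d = ((-s : ℝ) : ℂ) • (j d * j d) - j d * j d * j d := by
    have := congrArg j hd2
    rw [← Complex.coe_smul (-s)] at this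
    simpa only [map_mul, map_sub, map_smul] using this
  have hcd := hij c d
  have key := (hcd.mul_nonneg hic hjd).isSelfAdjoint.conjugate_nonneg hab
  have E : i c * j d * (i a + j b) * (i c * j d) =
      - (i (c * c * c) * j (d * d) + i (c * c) * j (d * d * d)) := by
    have h1 : i c * j d * i a * (i c * j d) = (i c * i a * i c) * (j d * j d) := by
      rw [mul_assoc (i c) (j d), ← (hij a d).eq]
      simp only [mul_assoc]
      rw [← mul_assoc (j d) (i c), ← (hij c d).eq]
      simp only [mul_assoc]
    have h2 : i c * j d * j b * (i c * j d) = (i c * i c) * (j d * j b * j d) := by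
      have : i c * j d * j b * (i c * j d) = i c * (j (d * b) * i c) * j d := by
        simp only [map_mul, mul_assoc]
      rw [this, ← (hij c (d * b)).eq]
      simp only [map_mul, mul_assoc]
    rw [mul_add, add_mul, h1, h2, e1, e2]
    simp only [map_mul, sub_mul, mul_sub, smul_mul_assoc, mul_smul_comm, mul_assoc]
    push_cast
    rw [neg_smul]
    abel
  rw [E, neg_nonneg] at key
  have p1 : 0 ≤ i (c * c * c) * j (d * d) := by
    refine (hij _ _).mul_nonneg (map_nonneg i ?_) (map_nonneg j ?_)
    · exact conjugate_nonneg_of_nonneg hc hc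
    · exact (Commute.refl d).mul_nonneg hd hd
  have p2 : 0 ≤ i (c * c) * j (d * d * d) := by
    refine (hij _ _).mul_nonneg (map_nonneg i ?_) (map_nonneg j ?_)
    · exact (Commute.refl c).mul_nonneg hc hc
    · exact conjugate_nonneg_of_nonneg hd hd
  have z : i (c * c * c) * j (d * d) = 0 :=
    le_antisymm ((le_add_of_nonneg_right p2).trans key) p1
  rcases h0 _ _ z with h | h
  · left
    apply hc3
    apply eq_zero_of_mul_self hc
    apply eq_zero_of_mul_self ((Commute.refl c).mul_nonneg hc hc)
    rw [← mul_assoc, h, zero_mul]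
  · right
    exact hd3 (eq_zero_of_mul_self hd h)

theorem apply_eq_re (ρ : CStarState A) {a : A} (ha : IsSelfAdjoint a) : ρ a = ((ρ a).re : ℂ) := by
  have h : star (ρ a) = ρ a := by
    have : IsSelfAdjoint (ρ.toPositiveLinearMap a) := ha.map ρ.toPositiveLinearMap
    exact this
  exact (Complex.conj_eq_iff_re.1 h).symm

theorem le_re_apply (ρ : CStarState A) {a : A} {s : ℝ} (h : algebraMap ℝ A s ≤ a) :
    s ≤ (ρ a).re := by
  have h1 := OrderHomClass.mono ρ h
  have h2 : ρ (algebraMap ℝ A s) = (s : ℂ) := by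
    rw [Algebra.algebraMap_eq_smul_one, ← Complex.coe_smul s, map_smul, ρ.map_one]
    simp
  rw [h2] at h1
  simpa using (Complex.le_def.1 h1).1

theorem re_add_nonneg (i : A →⋆ₐ[ℂ] D) (j : B →⋆ₐ[ℂ] D)
    (hij : ∀ a b, Commute (i a) (j b)) (h0 : ∀ a b, i a * j b = 0 → a = 0 ∨ b = 0)
    (ρ : CStarState A) (τ : CStarState B)
    {a : A} {b : B} (ha : IsSelfAdjoint a) (hb : IsSelfAdjoint b) (hab : 0 ≤ i a + j b) :
    0 ≤ (ρ a).re + (τ b).re := by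
  by_contra! hlt
  rcases le_or_le_of_add_nonneg i j hij h0 ha hb hab (((ρ a).re - (τ b).re) / 2) with h | h
  · have := le_re_apply ρ h
    linarith
  · have := le_re_apply τ h
    linarith

/-- Hahn-Banach: two states on commuting independent subalgebras have a common extension. -/
theorem exists_joint_extension (i : A →⋆ₐ[ℂ] D) (j : B →⋆ₐ[ℂ] D)
    (hij : ∀ a b, Commute (i a) (j b)) (h0 : ∀ a b, i a * j b = 0 → a = 0 ∨ b = 0)
    (ρ : CStarState A) (τ : CStarState B) :
    ∃ ω : CStarState D, (∀ a, ω (i a) = ρ a) ∧ ∀ b, ω (j b) = τ b := by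
  let Φ : (A × B × D) →ₗ[ℝ] D :=
    { toFun := fun x => i x.1 + j x.2.1 + x.2.2
      map_add' := fun x y => by
        simp only [Prod.fst_add, Prod.snd_add, map_add]
        abel
      map_smul' := fun r x => by
        simp only [Prod.smul_fst, Prod.smul_snd, RingHom.id_apply, smul_add,
          ← Complex.coe_smul r, map_smul] }
  let F : (A × B × D) →ₗ[ℝ] ℝ :=
    { toFun := fun x => (ρ x.1).re + (τ x.2.1).re
      map_add' := fun x y => by
        simp only [Prod.fst_add, Prod.snd_add, map_add, Complex.add_re]
        ring
      map_smul' := fun r x => by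
        simp only [Prod.smul_fst, Prod.smul_snd, RingHom.id_apply, smul_eq_mul,
          ← Complex.coe_smul r, map_smul, Complex.re_ofReal_mul]
        ring }
  let K : PointedCone ℝ (A × B × D) :=
    { carrier := {x | 0 ≤ Φ x + star (Φ x)}
      add_mem' := fun {x y} hx hy => by
        simp only [Set.mem_ofPred_eq] at hx hy ⊢
        have : Φ (x + y) + star (Φ (x + y)) = (Φ x + star (Φ x)) + (Φ y + star (Φ y)) := by
          rw [map_add, star_add]
          abel
        rw [this]
        exact add_nonneg hx hy
      zero_mem' := by simp
      smul_mem' := fun r x hx => by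
        simp only [Set.mem_ofPred_eq] at hx ⊢
        have : Φ (r • x) + star (Φ (r • x)) = (r : ℝ) • (Φ x + star (Φ x)) := by
          change Φ ((r : ℝ) • x) + star (Φ ((r : ℝ) • x)) = _
          rw [map_smul, star_smul, star_trivial, smul_add]
        rw [this]
        exact smul_nonneg r.2 hx }
  have hK : ∀ x, x ∈ K ↔ 0 ≤ Φ x + star (Φ x) := fun x => Iff.rfl
  let V : Submodule ℝ (A × B × D) :=
    LinearMap.ker ((LinearMap.snd ℝ B D).comp (LinearMap.snd ℝ A (B × D)))
  have hV : ∀ x, x ∈ V ↔ x.2.2 = 0 := fun x => LinearMap.mem_ker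
  obtain ⟨G, hG1, hG2⟩ := riesz_extension K ⟨V, F.domRestrict V⟩
    (by
      rintro ⟨⟨a, b, d⟩, hx⟩ hxK
      have hd : d = 0 := (hV _).1 hx
      subst hd
      have hp : 0 ≤ i (a + star a) + j (b + star b) := by
        have : i (a + star a) + j (b + star b)
            = (i a + j b + 0) + star (i a + j b + 0) := by
          simp only [map_add, map_star, star_add, add_zero]
          abel
        rw [this]
        exact (hK _).1 hxK
      have := re_add_nonneg i j hij h0 ρ τ (IsSelfAdjoint.add_star_self a)
        (IsSelfAdjoint.add_star_self b) hp
      have e1 : (ρ (star a)).re = (ρ a).re := by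
        have : ρ (star a) = star (ρ a) := map_star ρ.toPositiveLinearMap a
        rw [this]; simp
      have e2 : (τ (star b)).re = (τ b).re := by
        have : τ (star b) = star (τ b) := map_star τ.toPositiveLinearMap b
        rw [this]; simp
      rw [map_add, map_add, Complex.add_re, Complex.add_re, e1, e2] at this
      change 0 ≤ (ρ a).re + (τ b).re
      linarith)
    (by
      rintro ⟨a, b, d⟩
      let r : ℝ := ‖d + star d‖
      refine ⟨⟨(algebraMap ℝ A r - a, -b, 0), (hV _).2 rfl⟩, (hK _).2 ?_⟩
      have hr : Φ ((algebraMap ℝ A r - a, -b, 0) + (a, b, d)) = algebraMap ℝ D r + d := by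
        change i (algebraMap ℝ A r - a + a) + j (-b + b) + (0 + d) = _
        rw [sub_add_cancel, neg_add_cancel, map_zero, add_zero, zero_add,
          Algebra.algebraMap_eq_smul_one, Algebra.algebraMap_eq_smul_one,
          ← Complex.coe_smul r, map_smul, map_one, Complex.coe_smul]
      change 0 ≤ Φ ((algebraMap ℝ A r - a, -b, 0) + (a, b, d)) +
        star (Φ ((algebraMap ℝ A r - a, -b, 0) + (a, b, d)))
      rw [hr, star_add]
      have hs : star (algebraMap ℝ D r) = algebraMap ℝ D r :=
        (IsSelfAdjoint.algebraMap D (.all r)).star_eq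
      rw [hs]
      have h1 : -(algebraMap ℝ D r) ≤ d + star d :=
        IsSelfAdjoint.neg_algebraMap_norm_le_self (IsSelfAdjoint.add_star_self d)
      have h2 : 0 ≤ algebraMap ℝ D r := algebraMap_nonneg D (norm_nonneg _)
      have h3 : 0 ≤ algebraMap ℝ D r + (d + star d) := by
        rwa [neg_le_iff_add_nonneg, add_comm] at h1
      have : algebraMap ℝ D r + d + (algebraMap ℝ D r + star d)
          = algebraMap ℝ D r + (algebraMap ℝ D r + (d + star d)) := by abel
      rw [this]
      exact add_nonneg h2 h3)
  have hGA : ∀ a b, G (a, b, 0) = (ρ a).re + (τ b).re := fun a b =>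
    hG1 ⟨(a, b, 0), (hV _).2 rfl⟩
  have hskew : ∀ x, Φ x + star (Φ x) = 0 → G x = 0 := by
    intro x hx
    have h1 := hG2 x ((hK x).2 hx.ge)
    have h2 := hG2 (-x) ((hK _).2 (by
      rw [map_neg, star_neg, ← neg_add, hx, neg_zero]))
    rw [map_neg] at h2
    linarith
  let g : D →ₗ[ℝ] ℝ := G.comp ((LinearMap.inr ℝ A (B × D)).comp (LinearMap.inr ℝ B D))
  have hg : ∀ d, g d = G (0, 0, d) := fun d => rfl
  have hΦ : ∀ a b d, Φ (a, b, d) = i a + j b + d := fun a b d => rfl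
  have hgi : ∀ a, g (i a) = (ρ a).re := by
    intro a
    have h := hskew (a, 0, -i a) (by rw [hΦ]; simp)
    have : ((a, 0, -i a) : A × B × D) = (a, 0, 0) - (0, 0, i a) := by simp
    rw [this, map_sub, hGA, ← hg] at h
    simp at h
    linarith
  have hgj : ∀ b, g (j b) = (τ b).re := by
    intro b
    have h := hskew (0, b, -j b) (by rw [hΦ]; simp)
    have : ((0, b, -j b) : A × B × D) = (0, b, 0) - (0, 0, j b) := by simp
    rw [this, map_sub, hGA, ← hg] at h
    simp at h
    linarith
  let f : D →ₗ[ℂ] ℂ := Module.Dual.extendRCLike g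
  have hf : ∀ d, f d = (g d : ℂ) - Complex.I * (g (Complex.I • d) : ℂ) := fun d =>
    Module.Dual.extendRCLike_apply g d
  have hfi : ∀ a, f (i a) = ρ a := by
    intro a
    rw [hf, ← map_smul, hgi, hgi, map_smul]
    apply Complex.ext <;> simp
  have hfj : ∀ b, f (j b) = τ b := by
    intro b
    rw [hf, ← map_smul, hgj, hgj, map_smul]
    apply Complex.ext <;> simp
  refine ⟨mk₀ f (fun d hd => ?_) ?_, hfi, hfj⟩
  · have h1 : g (Complex.I • d) = 0 := by
      rw [hg]
      apply hskew
      rw [hΦ]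
      simp [hd.isSelfAdjoint.star_eq]
    have h2 : 0 ≤ g d := by
      rw [hg]
      apply hG2
      rw [hK, hΦ]
      simpa [hd.isSelfAdjoint.star_eq] using add_nonneg hd hd
    rw [hf, h1]
    simpa using h2
  · have := hfi 1
    rwa [map_one, ρ.map_one] at this

/-- If `ω` restricts to an extreme point of the state space of `A`, then it factorizes. -/
theorem factor_of_extreme (i : A →⋆ₐ[ℂ] D) (j : B →⋆ₐ[ℂ] D)
    (hij : ∀ a b, Commute (i a) (j b)) (ω : CStarState D) (ρ : CStarState A)
    (hρ : (ρ : A → ℂ) ∈ (Set.range fun σ : CStarState A => (σ : A → ℂ)).extremePoints ℝ)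
    (hω : ∀ a, ω (i a) = ρ a) (a : A) (b : B) : ω (i a * j b) = ρ a * ω (j b) := by
  -- first for `0 < b < 1` in a strict sense
  have main : ∀ b : B, 0 ≤ b → 0 ≤ 1 - b → 0 < (ω (j b)).re → (ω (j b)).re < 1 →
      ∀ a, ω (i a * j b) = ρ a * ω (j b) := by
    intro b hb hb1 hp hp1 a
    have hreal : ω (j b) = ((ω (j b)).re : ℂ) :=
      apply_eq_re ω (hb.isSelfAdjoint.map j)
    set t : ℝ := (ω (j b)).re with ht
    have mkst : ∀ (b : B) (s : ℝ), 0 ≤ b → ω (j b) = (s : ℂ) → 0 < s →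
        ∃ σ : CStarState A, ∀ a, σ a = (s : ℂ)⁻¹ * ω (i a * j b) := by
      intro b s hb hs hs0
      refine ⟨mk₀
        { toFun := fun a => (s : ℂ)⁻¹ * ω (i a * j b)
          map_add' := fun x y => by rw [map_add, add_mul, map_add, mul_add]
          map_smul' := fun c x => by
            rw [map_smul, smul_mul_assoc, map_smul, RingHom.id_apply, smul_eq_mul, smul_eq_mul]
            ring }
        (fun x hx => ?_) ?_, fun a => rfl⟩
      · change 0 ≤ (s : ℂ)⁻¹ * ω (i x * j b)
        refine mul_nonneg ?_ (map_nonneg ω ((hij x b).mul_nonneg (map_nonneg i hx)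
          (map_nonneg j hb)))
        rw [← Complex.ofReal_inv]
        exact_mod_cast (inv_pos.2 hs0).le
      · change (s : ℂ)⁻¹ * ω (i 1 * j b) = 1
        rw [map_one, one_mul, hs]
        exact inv_mul_cancel₀ (by exact_mod_cast hs0.ne')
    obtain ⟨σ₁, h₁⟩ := mkst b t hb hreal hp
    obtain ⟨σ₂, h₂⟩ := mkst (1 - b) (1 - t) hb1
      (by rw [map_sub, map_sub, map_one, ω.map_one, hreal]; push_cast; rfl) (by linarith)
    have hseg : (ρ : A → ℂ) ∈ openSegment ℝ (σ₁ : A → ℂ) (σ₂ : A → ℂ) := by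
      refine ⟨t, 1 - t, hp, by linarith, by ring, ?_⟩
      funext x
      have ht0 : (t : ℂ) ≠ 0 := by exact_mod_cast hp.ne'
      have ht1 : ((1 - t : ℝ) : ℂ) ≠ 0 := by
        exact_mod_cast (by linarith : 0 < 1 - t).ne'
      simp only [Pi.add_apply, Pi.smul_apply, Complex.real_smul]
      rw [h₁, h₂, mul_inv_cancel_left₀ ht0, mul_inv_cancel_left₀ ht1, map_sub, map_one, mul_sub,
        mul_one, map_sub, hω]
      ring
    have := hρ.2 ⟨σ₁, rfl⟩ ⟨σ₂, rfl⟩ hseg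
    have h : σ₁ a = ρ a := congrFun this a
    rw [h₁] at h
    rw [← h, hreal]
    have ht0 : (t : ℂ) ≠ 0 := by exact_mod_cast hp.ne'
    field_simp
  -- then for all nonnegative `b`, by an affine change of variable
  have pos : ∀ b : B, 0 ≤ b → ω (i a * j b) = ρ a * ω (j b) := by
    intro b hb
    let r : ℝ := 3 * (‖b‖ + 1)
    have hr : 0 < r := by positivity
    have hnb : b ≤ algebraMap ℝ B ‖b‖ := IsSelfAdjoint.le_algebraMap_norm_self hb.isSelfAdjoint
    let b' : B := algebraMap ℝ B (1 / 3) + r⁻¹ • b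
    have hb'0 : 0 ≤ b' :=
      add_nonneg (algebraMap_nonneg B (by norm_num)) (smul_nonneg (inv_pos.2 hr).le hb)
    have hsm : r⁻¹ • b ≤ algebraMap ℝ B (1 / 3) := by
      have h1 : r⁻¹ • b ≤ r⁻¹ • algebraMap ℝ B ‖b‖ :=
        smul_le_smul_of_nonneg_left hnb (inv_pos.2 hr).le
      refine h1.trans ?_
      rw [Algebra.algebraMap_eq_smul_one, Algebra.algebraMap_eq_smul_one, smul_smul]
      refine smul_le_smul_of_nonneg_right ?_ zero_le_one
      change (3 * (‖b‖ + 1))⁻¹ * ‖b‖ ≤ 1 / 3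
      have := norm_nonneg b
      rw [inv_mul_le_iff₀ (by positivity)]
      linarith
    have hb'1 : algebraMap ℝ B (1 / 3) ≤ 1 - b' := by
      rw [le_sub_iff_add_le]
      have h3 : (1 : B) = algebraMap ℝ B (1 / 3) + (algebraMap ℝ B (1 / 3) +
          algebraMap ℝ B (1 / 3)) := by
        rw [← map_add, ← map_add]
        norm_num
      conv_rhs => rw [h3]
      exact add_le_add_right (add_le_add_right hsm _) _
    have hlow : algebraMap ℝ B (1 / 3) ≤ b' :=
      le_add_of_nonneg_right (smul_nonneg (inv_pos.2 hr).le hb)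
    have l1 := le_re_apply (pullback j ω) hlow
    have l2 := le_re_apply (pullback j ω) hb'1
    rw [map_sub, (pullback j ω).map_one] at l2
    simp only [pullback_apply, Complex.sub_re, Complex.one_re] at l1 l2
    have h := main b' hb'0 ((algebraMap_nonneg B (by norm_num)).trans hb'1)
      (by linarith) (by linarith) a
    have hb' : j b' = ((1 / 3 : ℝ) : ℂ) • 1 + ((r⁻¹ : ℝ) : ℂ) • j b := by
      change j (algebraMap ℝ B (1 / 3) + r⁻¹ • b) = _
      rw [map_add, Algebra.algebraMap_eq_smul_one, ← Complex.coe_smul (1 / 3 : ℝ),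
        ← Complex.coe_smul r⁻¹, map_smul, map_smul, map_one]
    rw [hb', mul_add, mul_smul_comm, mul_smul_comm, mul_one] at h
    simp only [map_add, map_smul, smul_eq_mul, ω.map_one, hω] at h
    have hr' : ((r⁻¹ : ℝ) : ℂ) ≠ 0 := by exact_mod_cast (inv_pos.2 hr).ne'
    apply mul_left_cancel₀ hr'
    linear_combination h
  obtain ⟨y, hy0, -, hy⟩ := CStarAlgebra.exists_sum_four_nonneg b
  rw [hy]
  simp only [map_sum, map_smul, Finset.mul_sum, mul_smul_comm, smul_eq_mul]
  refine Finset.sum_congr rfl fun k _ => ?_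
  rw [pos _ (hy0 k)]
  ring

theorem isClosed_range_coe : IsClosed (Set.range fun σ : CStarState A => (σ : A → ℂ)) := by
  have : (Set.range fun σ : CStarState A => (σ : A → ℂ)) =
      {f | (∀ x y, f (x + y) = f x + f y) ∧ (∀ (c : ℂ) x, f (c • x) = c * f x) ∧
        (∀ x, 0 ≤ x → 0 ≤ f x) ∧ f 1 = 1} := by
    ext f
    constructor
    · rintro ⟨σ, rfl⟩
      exact ⟨fun x y => map_add σ x y, fun c x => map_smul σ c x,
        fun x hx => map_nonneg σ hx, σ.map_one⟩
    · rintro ⟨h1, h2, h3, h4⟩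
      exact ⟨mk₀ { toFun := f, map_add' := h1, map_smul' := h2 } h3 h4, rfl⟩
  rw [this]
  simp only [Set.ofPred_and, Set.ofPred_forall]
  refine IsClosed.inter ?_ (IsClosed.inter ?_ (IsClosed.inter ?_ ?_))
  · exact isClosed_iInter fun x => isClosed_iInter fun y =>
      isClosed_eq (by fun_prop) (by fun_prop)
  · exact isClosed_iInter fun x => isClosed_iInter fun y =>
      isClosed_eq (by fun_prop) (by fun_prop)
  · exact isClosed_iInter fun x => isClosed_iInter fun _ =>
      isClosed_le (by fun_prop) (by fun_prop)
  · exact isClosed_eq (by fun_prop) (by fun_prop)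

theorem isCompact_range_coe : IsCompact (Set.range fun σ : CStarState A => (σ : A → ℂ)) := by
  refine (isCompact_univ_pi (s := fun a : A => Metric.closedBall (0 : ℂ) (4 * ‖a‖))
    fun a => isCompact_closedBall _ _).of_isClosed_subset isClosed_range_coe ?_
  rintro _ ⟨σ, rfl⟩ a -
  simpa using norm_apply_le σ a

theorem exists_convex_comb (σ₁ σ₂ : CStarState A) {s t : ℝ} (hs : 0 ≤ s) (ht : 0 ≤ t)
    (hst : s + t = 1) : ∃ σ : CStarState A, ∀ a, σ a = s * σ₁ a + t * σ₂ a := by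
  refine ⟨mk₀ ((s : ℂ) • σ₁.toPositiveLinearMap.toLinearMap +
    (t : ℂ) • σ₂.toPositiveLinearMap.toLinearMap) (fun a ha => ?_) ?_, fun a => rfl⟩
  · change 0 ≤ (s : ℂ) * σ₁ a + (t : ℂ) * σ₂ a
    exact add_nonneg (mul_nonneg (by exact_mod_cast hs) (map_nonneg σ₁ ha))
      (mul_nonneg (by exact_mod_cast ht) (map_nonneg σ₂ ha))
  · change (s : ℂ) * σ₁ 1 + (t : ℂ) * σ₂ 1 = 1
    rw [σ₁.map_one, σ₂.map_one, mul_one, mul_one]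
    exact_mod_cast hst

/-- Product states exist on any C⋆-algebra containing commuting independent copies of two
C⋆-algebras. -/
theorem exists_product (i : A →⋆ₐ[ℂ] D) (j : B →⋆ₐ[ℂ] D)
    (hij : ∀ a b, Commute (i a) (j b)) (h0 : ∀ a b, i a * j b = 0 → a = 0 ∨ b = 0)
    (ρ : CStarState A) (τ : CStarState B) :
    ∃ ω : CStarState D, ∀ a b, ω (i a * j b) = ρ a * τ b := by
  let S : Set (A → ℂ) := Set.range fun σ : CStarState A => (σ : A → ℂ)
  let W : Set (D → ℂ) := (Set.range fun σ : CStarState D => (σ : D → ℂ)) ∩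
    {f | ∀ a b, f (i a * j b) = f (i a) * τ b}
  let T : Set (A → ℂ) := (fun f : D → ℂ => fun a => f (i a)) '' W
  have hTc : IsCompact T := by
    refine IsCompact.image (isCompact_range_coe.inter_right ?_) (by fun_prop)
    simp only [Set.ofPred_forall]
    exact isClosed_iInter fun x => isClosed_iInter fun y =>
      isClosed_eq (by fun_prop) (by fun_prop)
  have hTv : Convex ℝ T := by
    rintro _ ⟨_, ⟨⟨ω₁, rfl⟩, h₁⟩, rfl⟩ _ ⟨_, ⟨⟨ω₂, rfl⟩, h₂⟩, rfl⟩ s t hs ht hst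
    obtain ⟨ω, hω⟩ := exists_convex_comb ω₁ ω₂ hs ht hst
    refine ⟨ω, ⟨⟨ω, rfl⟩, fun a b => ?_⟩, ?_⟩
    · have e1 : ω₁ (i a * j b) = ω₁ (i a) * τ b := h₁ a b
      have e2 : ω₂ (i a * j b) = ω₂ (i a) * τ b := h₂ a b
      rw [hω, hω, e1, e2]
      ring
    · funext a
      simp only [hω, Pi.add_apply, Pi.smul_apply, Complex.real_smul]
  have hSv : Convex ℝ S := by
    rintro _ ⟨σ₁, rfl⟩ _ ⟨σ₂, rfl⟩ s t hs ht hst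
    obtain ⟨σ, hσ⟩ := exists_convex_comb σ₁ σ₂ hs ht hst
    refine ⟨σ, ?_⟩
    funext a
    simp only [hσ, Pi.add_apply, Pi.smul_apply, Complex.real_smul]
  have hext : S.extremePoints ℝ ⊆ T := by
    rintro _ ⟨⟨σ, rfl⟩, hσ⟩
    obtain ⟨ω, h1, h2⟩ := exists_joint_extension i j hij h0 σ τ
    refine ⟨ω, ⟨⟨ω, rfl⟩, fun a b => ?_⟩, funext h1⟩
    rw [factor_of_extreme i j hij ω σ ⟨⟨σ, rfl⟩, hσ⟩ h1, h1, h2]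
  have hST : S ⊆ T := by
    have hSc : IsCompact S := isCompact_range_coe
    rw [← closure_convexHull_extremePoints hSc hSv]
    exact closure_minimal (convexHull_min hext hTv) hTc.isClosed
  obtain ⟨_, ⟨⟨ω, rfl⟩, h⟩, h'⟩ := hST ⟨ρ, rfl⟩
  refine ⟨ω, fun a b => ?_⟩
  have e : ω (i a * j b) = ω (i a) * τ b := h a b
  have e' : ω (i a) = ρ a := congrFun h' a
  rw [e, e']

end Extension

end CStarState

/-- `ι : A ⊗ B → D` exhibits `D` as a C⋆-tensor product of `A` and `B`, i.e. as the completion of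
the algebraic tensor product in some C⋆-norm. -/
structure IsCStarTensorProduct {A B D : Type*} [CStarAlgebra A] [CStarAlgebra B] [CStarAlgebra D]
    (ι : A ⊗[ℂ] B →⋆ₐ[ℂ] D) : Prop where
  injective : Function.Injective ι
  denseRange : DenseRange ι

namespace IsCStarTensorProduct

variable {A B D : Type*}
  [CStarAlgebra A] [PartialOrder A] [StarOrderedRing A]
  [CStarAlgebra B] [PartialOrder B] [StarOrderedRing B]
  [CStarAlgebra D] [PartialOrder D] [StarOrderedRing D]
  {ι : A ⊗[ℂ] B →⋆ₐ[ℂ] D}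

theorem existsUnique_productState (h : IsCStarTensorProduct ι)
    (ρ : CStarState A) (τ : CStarState B) :
    ∃! ω : CStarState D, ∀ a b, ω (ι (a ⊗ₜ[ℂ] b)) = ρ a * τ b := by
  let i : A →⋆ₐ[ℂ] D :=
    { ι.toAlgHom.comp Algebra.TensorProduct.includeLeft with
      map_star' := fun a => by
        change ι (star a ⊗ₜ 1) = star (ι (a ⊗ₜ 1))
        rw [← map_star, TensorProduct.star_tmul, star_one] }
  let j : B →⋆ₐ[ℂ] D :=
    { ι.toAlgHom.comp Algebra.TensorProduct.includeRight with
      map_star' := fun a => by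
        change ι (1 ⊗ₜ star a) = star (ι (1 ⊗ₜ a))
        rw [← map_star, TensorProduct.star_tmul, star_one] }
  have hprod : ∀ a b, i a * j b = ι (a ⊗ₜ b) := fun a b => by
    change ι (a ⊗ₜ 1) * ι (1 ⊗ₜ b) = _
    rw [← map_mul, Algebra.TensorProduct.tmul_mul_tmul, one_mul, mul_one]
  have hij : ∀ a b, Commute (i a) (j b) := fun a b => by
    change i a * j b = ι (1 ⊗ₜ b) * ι (a ⊗ₜ 1)
    rw [hprod, ← map_mul, Algebra.TensorProduct.tmul_mul_tmul, one_mul, mul_one]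
  have h0 : ∀ a b, i a * j b = 0 → a = 0 ∨ b = 0 := fun a b hab => by
    rw [hprod] at hab
    have : a ⊗ₜ[ℂ] b = 0 := h.injective (by rw [hab, map_zero])
    by_contra! hne
    obtain ⟨f, hf⟩ : ∃ f : Module.Dual ℂ A, f a ≠ 0 := by
      by_contra! hall
      exact hne.1 ((Module.forall_dual_apply_eq_zero_iff ℂ a).1 hall)
    have h2 := congrArg (fun z => TensorProduct.lid ℂ B (f.rTensor B z)) this
    simp [hf, hne.2] at h2
  obtain ⟨ω, hω⟩ := CStarState.exists_product i j hij h0 ρ τ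
  refine ⟨ω, fun a b => by rw [← hprod, hω], fun ω' hω' => ?_⟩
  have hc : ∀ σ : CStarState D, Continuous σ := fun σ =>
    map_continuous σ.toPositiveLinearMap
  apply DFunLike.coe_injective
  refine h.denseRange.equalizer (hc ω') (hc ω) (funext fun x => ?_)
  induction x with
  | zero => simp
  | tmul a b => exact (hω' a b).trans (by rw [Function.comp_apply, ← hprod, hω])
  | add x y hx hy =>
    simp only [Function.comp_apply, map_add] at hx hy ⊢
    rw [hx, hy]

/-- The product state `ρ ⊗ τ`: the unique state of the tensor product with
`(ρ ⊗ τ)(a ⊗ b) = ρ(a) τ(b)`. -/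
noncomputable def productState (h : IsCStarTensorProduct ι)
    (ρ : CStarState A) (τ : CStarState B) : CStarState D :=
  (h.existsUnique_productState ρ τ).choose

theorem productState_tmul (h : IsCStarTensorProduct ι)
    (ρ : CStarState A) (τ : CStarState B) (a : A) (b : B) :
    h.productState ρ τ (ι (a ⊗ₜ[ℂ] b)) = ρ a * τ b :=
  (h.existsUnique_productState ρ τ).choose_spec.1 a b

theorem eq_productState (h : IsCStarTensorProduct ι)
    (ρ : CStarState A) (τ : CStarState B) (ω : CStarState D)
    (hω : ∀ a b, ω (ι (a ⊗ₜ[ℂ] b)) = ρ a * τ b) : ω = h.productState ρ τ :=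
  (h.existsUnique_productState ρ τ).choose_spec.2 ω hω

/-- The map `M^*(ρ) = α^*(ρ ⊗ τ)` on states. -/
noncomputable def measurement (h : IsCStarTensorProduct ι) (α : D ≃⋆ₐ[ℂ] D)
    (τ : CStarState B) (ρ : CStarState A) : CStarState D :=
  CStarState.pullback (α : D →⋆ₐ[ℂ] D) (h.productState ρ τ)

end IsCStarTensorProduct

/-!
Write `ω = ρ ⊗ τ`, `p = ι (P ⊗ 1)` and `R = α Q`, a projection. Slicing `ω` by elements of `A` stays
within product states: for `Y ∈ A` and `y = ι (Y ⊗ 1)`, the reduced state `ω_y` is `ρ_Y ⊗ τ`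
(`reduced_productState`).

The hypothesis says `(σ ⊗ τ)(R) = σ(P)` for every state `σ` of `A`. For `σ = ρ_{1 - P}` it gives
`ω((1 - p) R (1 - p)) = 0`, so `R (1 - p)` lies in the left kernel of `ω`; the same argument for the
complementary projections puts `(1 - R) p` in the left kernel
(`productState_mul_mul_one_sub_eq_zero`). As `R - p = R (1 - p) - (1 - R) p`, the Cauchy-Schwarz
inequality shows that `R` and `p` may be exchanged at either end of the argument of `ω`
(`productState_mul_eq`, `productState_eq_mul`). Hence `ω(R x R) = ω(p x p)` for all `x`, and
the right-hand side is `ρ(P) (ρ_P ⊗ τ)(x)`.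
-/

namespace CStarState

variable {A : Type*} [CStarAlgebra A] [PartialOrder A] [StarOrderedRing A]

theorem map_star' (ρ : CStarState A) (a : A) : ρ (star a) = star (ρ a) :=
  map_star ρ.toPositiveLinearMap a

/-- The left kernel of a state annihilates everything on the left, by the Cauchy-Schwarz inequality
in the GNS space. -/
theorem apply_mul_eq_zero (ρ : CStarState A) {y : A} (hy : ρ (star y * y) = 0) (z : A) :
    ρ (z * y) = 0 := by
  let f := ρ.toPositiveLinearMap
  have hn : ‖f.toPreGNS y‖ = 0 := by
    have h := f.preGNS_norm_sq (f.toPreGNS y)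
    rw [f.ofPreGNS_toPreGNS, show f (star y * y) = 0 from hy] at h
    exact_mod_cast pow_eq_zero_iff two_ne_zero |>.1 h
  have hi := norm_inner_le_norm (𝕜 := ℂ) (f.toPreGNS (star z)) (f.toPreGNS y)
  rw [hn, mul_zero, f.preGNS_inner_def, f.ofPreGNS_toPreGNS, f.ofPreGNS_toPreGNS, star_star] at hi
  exact norm_le_zero_iff.1 hi

theorem reduced_apply (ρ : CStarState A) (Y : A) (hY : ρ (star Y * Y) ≠ 0) (a : A) :
    ρ.reduced Y hY a = ρ (star Y * a * Y) / ρ (star Y * Y) := rfl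

end CStarState

namespace IsCStarTensorProduct

section Tmul

variable {A B D : Type*} [CStarAlgebra A] [CStarAlgebra B] [CStarAlgebra D]
  {ι : A ⊗[ℂ] B →⋆ₐ[ℂ] D}

theorem star_tmul_one (a : A) :
    star (ι (a ⊗ₜ[ℂ] (1 : B))) = ι (star a ⊗ₜ[ℂ] (1 : B)) := by
  rw [← map_star, TensorProduct.star_tmul, star_one]

theorem one_sub_tmul_one (a : A) :
    ι ((1 - a) ⊗ₜ[ℂ] (1 : B)) = 1 - ι (a ⊗ₜ[ℂ] (1 : B)) := by
  rw [TensorProduct.sub_tmul, map_sub, ← Algebra.TensorProduct.one_def, map_one]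

end Tmul

variable {A B D : Type*}
  [CStarAlgebra A] [PartialOrder A] [StarOrderedRing A]
  [CStarAlgebra B] [PartialOrder B] [StarOrderedRing B]
  [CStarAlgebra D] [PartialOrder D] [StarOrderedRing D]
  {ι : A ⊗[ℂ] B →⋆ₐ[ℂ] D}

theorem productState_tmul_one (h : IsCStarTensorProduct ι) (ρ : CStarState A) (τ : CStarState B)
    (a : A) : h.productState ρ τ (ι (a ⊗ₜ[ℂ] 1)) = ρ a := by
  rw [h.productState_tmul, τ.map_one, mul_one]

theorem productState_star_mul_tmul_one (h : IsCStarTensorProduct ι) (ρ : CStarState A)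
    (τ : CStarState B) (Y : A) :
    h.productState ρ τ (star (ι (Y ⊗ₜ[ℂ] 1)) * ι (Y ⊗ₜ[ℂ] 1)) = ρ (star Y * Y) := by
  rw [star_tmul_one, ← map_mul, Algebra.TensorProduct.tmul_mul_tmul, one_mul,
    h.productState_tmul_one]

/-- Reducing a product state by an element of the first factor reduces the first factor. -/
theorem reduced_productState (h : IsCStarTensorProduct ι) (ρ : CStarState A) (τ : CStarState B)
    (Y : A) (hY : ρ (star Y * Y) ≠ 0) :
    (h.productState ρ τ).reduced (ι (Y ⊗ₜ[ℂ] 1))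
      (by rwa [h.productState_star_mul_tmul_one]) = h.productState (ρ.reduced Y hY) τ := by
  refine h.eq_productState _ _ _ fun a b => ?_
  rw [CStarState.reduced_apply, CStarState.reduced_apply, h.productState_star_mul_tmul_one,
    star_tmul_one, ← map_mul, ← map_mul, Algebra.TensorProduct.tmul_mul_tmul,
    Algebra.TensorProduct.tmul_mul_tmul, one_mul, mul_one, h.productState_tmul, div_mul_eq_mul_div]

/-- If a projection `S` has the expectation of `E` in every product state with second factor `τ`,
then `S (1 - E ⊗ 1)` is in the left kernel of all these product states: its square has the
expectation of `E` in the state reduced by `1 - E`. -/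
theorem productState_mul_mul_one_sub_eq_zero (h : IsCStarTensorProduct ι) (τ : CStarState B)
    {E : A} (hE : IsStarProjection E) {S : D} (hS : IsStarProjection S)
    (hSE : ∀ σ : CStarState A, h.productState σ τ S = σ E) (ρ : CStarState A) (z : D) :
    h.productState ρ τ (z * (S * (1 - ι (E ⊗ₜ[ℂ] 1)))) = 0 := by
  rw [← one_sub_tmul_one]
  by_cases hF : ρ (star (1 - E) * (1 - E)) = 0
  -- Here `ρ` has no mass on `1 - E`, so `1 - E ⊗ 1` is itself in the left kernel.
  · rw [← mul_assoc]
    exact CStarState.apply_mul_eq_zero _ (by rwa [h.productState_star_mul_tmul_one]) _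
  · refine CStarState.apply_mul_eq_zero _ ?_ z
    have hred := hSE (ρ.reduced (1 - E) hF)
    rw [← h.reduced_productState ρ τ (1 - E) hF, CStarState.reduced_apply,
      CStarState.reduced_apply, mul_assoc _ E, hE.mul_one_sub_self, mul_zero, map_zero, zero_div,
      h.productState_star_mul_tmul_one, div_eq_zero_iff, or_iff_left hF] at hred
    rw [star_mul, hS.isSelfAdjoint.star_eq, mul_assoc, ← mul_assoc S, hS.isIdempotentElem.eq,
      ← mul_assoc]
    exact hred

/-- Right multiplication by `S` and by `E ⊗ 1` agree under the product state, because
`S - E ⊗ 1 = S (1 - E ⊗ 1) - (1 - S) (E ⊗ 1)` is in its left kernel. -/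
theorem productState_mul_eq (h : IsCStarTensorProduct ι) (τ : CStarState B)
    {E : A} (hE : IsStarProjection E) {S : D} (hS : IsStarProjection S)
    (hSE : ∀ σ : CStarState A, h.productState σ τ S = σ E) (ρ : CStarState A) (z : D) :
    h.productState ρ τ (z * S) = h.productState ρ τ (z * ι (E ⊗ₜ[ℂ] 1)) := by
  have h₁ := h.productState_mul_mul_one_sub_eq_zero τ hE hS hSE ρ z
  have h₂ := h.productState_mul_mul_one_sub_eq_zero τ hE.one_sub hS.one_sub
    (fun σ => by rw [map_sub, map_sub, hSE, CStarState.map_one, CStarState.map_one]) ρ z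
  rw [one_sub_tmul_one, sub_sub_cancel] at h₂
  rw [← sub_eq_zero, ← map_sub, ← sub_eq_zero.2 (h₁.trans h₂.symm), ← map_sub]
  congr 1
  noncomm_ring

theorem productState_eq_mul (h : IsCStarTensorProduct ι) (τ : CStarState B)
    {E : A} (hE : IsStarProjection E) {S : D} (hS : IsStarProjection S)
    (hSE : ∀ σ : CStarState A, h.productState σ τ S = σ E) (ρ : CStarState A) (z : D) :
    h.productState ρ τ (S * z) = h.productState ρ τ (ι (E ⊗ₜ[ℂ] 1) * z) := by
  have hz := congrArg star (h.productState_mul_eq τ hE hS hSE ρ (star z))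
  rwa [← CStarState.map_star', ← CStarState.map_star', star_mul, star_mul, star_star,
    hS.isSelfAdjoint.star_eq, star_tmul_one, hE.isSelfAdjoint.star_eq] at hz

end IsCStarTensorProduct

theorem mainTheorem2 {A B D : Type*}
    [CStarAlgebra A] [PartialOrder A] [StarOrderedRing A]
    [CStarAlgebra B] [PartialOrder B] [StarOrderedRing B]
    [CStarAlgebra D] [PartialOrder D] [StarOrderedRing D]
    (ι : A ⊗[ℂ] B →⋆ₐ[ℂ] D) (hι : IsCStarTensorProduct ι)
    (α : D ≃⋆ₐ[ℂ] D) (τ : CStarState B)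
    (P : A) (hP : IsStarProjection P) (Q : D) (hQ : IsStarProjection Q)
    (hM : ∀ ρ : CStarState A, hι.measurement α τ ρ Q = ρ P)
    (ρ : CStarState A) (hρ : ρ (star P * P) ≠ 0) :
    ∃ hρQ : hι.measurement α τ ρ (star Q * Q) ≠ 0,
      (hι.measurement α τ ρ).reduced Q hρQ = hι.measurement α τ (ρ.reduced P hρ) := by
  have happly : ∀ (σ : CStarState A) (x : D),
    hι.measurement α τ σ x = hι.productState σ τ (α x) := fun _ _ => rfl
  have hPP : star P * P = P := by rw [hP.isSelfAdjoint.star_eq, hP.isIdempotentElem.eq]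
  have hQQ : star Q * Q = Q := by rw [hQ.isSelfAdjoint.star_eq, hQ.isIdempotentElem.eq]
  have hR : IsStarProjection (α Q) :=
    ⟨hQ.isIdempotentElem.map α, hQ.isSelfAdjoint.map α⟩
  refine ⟨by rwa [hQQ, hM, ← hPP], CStarState.ext fun x => ?_⟩
  rw [CStarState.reduced_apply, happly (ρ.reduced P hρ), ← hι.reduced_productState,
    CStarState.reduced_apply, hι.productState_star_mul_tmul_one, hQQ, hM, hPP, happly, map_mul α,
    map_mul α, hQ.isSelfAdjoint.star_eq, hι.productState_mul_eq τ hP hR hM, mul_assoc,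
    hι.productState_eq_mul τ hP hR hM, IsCStarTensorProduct.star_tmul_one,
    hP.isSelfAdjoint.star_eq, mul_assoc]
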